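/- **Definitions.** Words are elements of the free monoid $\{a,b\}^*$. A right ideal is a set $R\subseteq\{a,b\}^*$ with $R\{a,b\}^*\subseteq R$; it is finitely generated if $R=C\{a,b\}^*$ for a finite set $C$ of words, and essential if it meets every non-empty right ideal. A right-ideal isomorphism is a bijection $\varphi:R_1\to R_2$ between right ideals such that $\varphi(ux)=\varphi(u)x$ for all $u\in R_1$, $x\in\{a,b\}^*$; it is maximal if it has no strict extension to a right-ideal isomorphism. Every isomorphism $\varphi$ between finitely generated essential right ideals has a greatest extension $\max\varphi$. The Thompson group $V$ consists of all maximal isomorphisms between finitely generated essential right ideals of $\{a,b\}^*$, with product $\varphi\cdot\psi=\max(\varphi\circ\psi)$ ($\psi$ is applied first). The isomorphism with table $\begin{bmatrix}u_1&\cdots&u_n\\ v_1&\cdots&v_n\end{bmatrix}$ is the one with domain $\bigcup_i u_i\{a,b\}^*$ and $u_ix\mapsto v_ix$. For $\varphi\in V$, $\varphi_a\in V$ is determined by $\varphi_a(ax)=a\varphi(x)$ for all $x$ in the domain of $\varphi$ and $\varphi_a(b)=b$; $\varphi_b\in V$ is determined by $\varphi_b(bx)=b\varphi(x)$ for all $x$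 in the domain of $\varphi$ and $\varphi_b(a)=a$. For a group $G$, a set $A\subseteq G$ and $g\in\langle A\rangle$, let $|g|_A$ be the least length of a word over $A^{\pm1}$ with value $g$. If $A$ is a finite generating set of $G$ and $X$ a finite generating set of a subgroup $H\le G$, a distortion function of $H$ in $G$ is a non-decreasing function $f:\mathbb N\to\mathbb N$ with $|g|_X\le f(|g|_A)$ for all $g\in H$. Functions $f_1,f_2:\mathbb N\to\mathbb N$ are linearly equivalent if there are positive integers $c_0,C_{12},c_{12},C_{21},c_{21}$ with $f_1(n)\le C_{12}f_2(c_{12}n)$ and $f_2(n)\le C_{21}f_1(c_{21}n)$ for all $n\ge c_0$. The subgroup $H$ has linear distortion in $G$ if, for all such finite $A$ and $X$, a (pointwise) minimum distortion function exists and is linearly equivalent to $n\mapsto n$. **Theorem.** Let $\alpha,\beta\in V$ be the elements with tables $$\alpha=\begin{bmatrix} a & b^3 & b^2ab & b^2a^3 & b^2a^2b & ba\\ b^4a & b^3a & b^2a & a & ba & b^5\end{bmatrix},\qquad \beta=\begin{bmatrix} b & ab & a^2b^2 & a^2ba^2 & a^2bab & a^3\\ a^3ba & a^3b^2 & a^2b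 & b & ab & a^4\end{bmatrix}.$$ 1. The subgroup $\langle\alpha,\beta\rangle$ of $V$ is free with basis $\alpha,\beta$ (so it is isomorphic to the free group $F_2$ of rank $2$), and it has linear distortion in $V$. 2. The subgroup $\langle\alpha_a,\beta_a,\alpha_b,\beta_b\rangle$ of $V$ is isomorphic to $F_2\times F_2$, through an isomorphism that sends the standard generators of the first factor to $\alpha_a,\beta_a$ and those of the second factor to $\alpha_b,\beta_b$; it has linear distortion in $V$. -/

import Mathlib

/-! ## Words over the two-letter alphabet and right ideals -/

namespace Thompson

/-- The alphabet has two letters, written `a` and `b`. -/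
abbrev Letter : Type := Bool

/-- The first letter. -/
abbrev a : Letter := false

/-- The second letter. -/
abbrev b : Letter := true

/-- Finite words over the alphabet; concatenation is `++` and the empty word is `[]`. -/
abbrev Word : Type := List Letter

/-- A set of words closed under appending arbitrary words on the right. -/
def IsRightIdeal (R : Set Word) : Prop :=
  ∀ u ∈ R, ∀ x : Word, u ++ x ∈ R

/-- `R` is of the form `C · A*` for a finite set of words `C`. -/
def IsFinGen (R : Set Word) : Prop :=
  ∃ C : Set Word, C.Finite ∧ R = {w | ∃ u ∈ C, ∃ x : Word, w = u ++ x}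

/-- `R` meets every (non-empty) right ideal. -/
def IsEssential (R : Set Word) : Prop :=
  ∀ J : Set Word, IsRightIdeal J → J.Nonempty → (R ∩ J).Nonempty

/-- The domain of a partial bijection. -/
def dom (f : Word ≃. Word) : Set Word := {u | ∃ v, v ∈ f u}

/-- The range of a partial bijection. -/
def ran (f : Word ≃. Word) : Set Word := {v | ∃ u, v ∈ f u}

/-- A right-ideal isomorphism: a bijection `φ` from a right ideal onto a right ideal such that
`φ (u x) = φ (u) x` for all `u` in the domain and all words `x`. -/
structure IsRightIdealIso (f : Word ≃. Word) : Prop where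
  dom_ideal : IsRightIdeal (dom f)
  ran_ideal : IsRightIdeal (ran f)
  map_append : ∀ u v x : Word, v ∈ f u → v ++ x ∈ f (u ++ x)

/-- A right-ideal isomorphism is maximal if it has no strict extension to a right-ideal
isomorphism (`f ≤ g` says that `g` extends `f`). -/
def IsMaximal (f : Word ≃. Word) : Prop :=
  ∀ g : Word ≃. Word, IsRightIdealIso g → f ≤ g → g = f

/-- Isomorphisms between finitely generated essential right ideals of `{a, b}*`. -/
structure EssIso where
  map : Word ≃. Word
  isIso : IsRightIdealIso map
  dom_finGen : IsFinGen (dom map)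
  dom_ess : IsEssential (dom map)
  ran_finGen : IsFinGen (ran map)
  ran_ess : IsEssential (ran map)

/-! ### Finitely generated essential right ideals contain all long words -/

theorem exists_len {R : Set Word} (hf : IsFinGen R) (he : IsEssential R) :
    ∃ N : ℕ, ∀ u : Word, N ≤ u.length → u ∈ R := by
  obtain ⟨C, hC, rfl⟩ := hf
  obtain ⟨N, hN⟩ := (hC.image List.length).bddAbove
  refine ⟨N, fun u hu => ?_⟩
  obtain ⟨w, ⟨c, hc, x, rfl⟩, y, hy⟩ := he {w | ∃ x, w = u ++ x}
    (by rintro _ ⟨x, rfl⟩ y; exact ⟨x ++ y, by simp⟩) ⟨u, [], by simp⟩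
  have hl : c.length ≤ u.length := le_trans (hN ⟨c, hc, rfl⟩) hu
  have hp : c <+: u := List.prefix_of_prefix_length_le (l₃ := c ++ x)
    (List.prefix_append _ _) (hy ▸ List.prefix_append _ _) hl
  obtain ⟨t, rfl⟩ := hp
  exact ⟨c, hc, t, rfl⟩

theorem finGen_of_len {R : Set Word} (hR : IsRightIdeal R) {N : ℕ}
    (hN : ∀ u : Word, N ≤ u.length → u ∈ R) : IsFinGen R := by
  refine ⟨{u | u ∈ R ∧ u.length ≤ N}, ?_, ?_⟩
  · exact (List.finite_length_le Letter N).subset fun u hu => hu.2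
  · ext w
    constructor
    · intro hw
      by_cases h : w.length ≤ N
      · exact ⟨w, ⟨hw, h⟩, [], by simp⟩
      · push Not at h
        have hl : (w.take N).length = N := by simp [h.le]
        exact ⟨w.take N, ⟨hN _ hl.ge, hl.le⟩, w.drop N, by simp⟩
    · rintro ⟨u, hu, x, rfl⟩
      exact hR u hu.1 x

theorem essential_of_len {R : Set Word} {N : ℕ}
    (hN : ∀ u : Word, N ≤ u.length → u ∈ R) : IsEssential R := by
  rintro J hJ ⟨u, hu⟩
  exact ⟨u ++ List.replicate N a, hN _ (by simp), hJ u hu _⟩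

theorem append_mem {R : Set Word} {N : ℕ} (hN : ∀ u : Word, N ≤ u.length → u ∈ R)
    (u : Word) : ∃ x, u ++ x ∈ R :=
  ⟨List.replicate N a, hN _ (by simp)⟩

namespace EssIso

theorem exists_dom (f : EssIso) (u : Word) : ∃ x, ∃ v, v ∈ f.map (u ++ x) := by
  obtain ⟨N, hN⟩ := exists_len f.dom_finGen f.dom_ess
  exact append_mem hN u

/-- An isomorphism, given by a map whose domain and range contain all long words. -/
def ofLen (f : Word ≃. Word) (hf : IsRightIdealIso f)
    (hd : ∃ N : ℕ, ∀ u : Word, N ≤ u.length → u ∈ dom f)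
    (hr : ∃ N : ℕ, ∀ u : Word, N ≤ u.length → u ∈ ran f) : EssIso where
  map := f
  isIso := hf
  dom_finGen := hd.elim fun _ h => finGen_of_len hf.dom_ideal h
  dom_ess := hd.elim fun _ h => essential_of_len h
  ran_finGen := hr.elim fun _ h => finGen_of_len hf.ran_ideal h
  ran_ess := hr.elim fun _ h => essential_of_len h

theorem ext_map {f g : EssIso} (h : f.map = g.map) : f = g := by
  cases f; cases g; cases h; rfl

/-! ### Identity, inverse and composition -/

/-- The identity map of `{a, b}*`. -/
def id : EssIso :=
  ofLen (PEquiv.refl Word)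
    ⟨fun u _ x => ⟨u ++ x, by simp⟩, fun u _ x => ⟨u ++ x, by simp⟩, by
      intro u v x h
      simp only [PEquiv.refl_apply, Option.mem_def, Option.some.injEq] at h ⊢
      rw [h]⟩
    ⟨0, fun u _ => ⟨u, by simp⟩⟩ ⟨0, fun u _ => ⟨u, by simp⟩⟩

theorem dom_symm (f : Word ≃. Word) : dom f.symm = ran f := by
  ext u; simp only [dom, ran, Set.mem_ofPred_eq, PEquiv.mem_iff_mem]

theorem ran_symm (f : Word ≃. Word) : ran f.symm = dom f := by
  ext u; simp only [dom, ran, Set.mem_ofPred_eq, PEquiv.mem_iff_mem]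

/-- The inverse isomorphism. -/
def symm (f : EssIso) : EssIso where
  map := f.map.symm
  isIso := ⟨by rw [dom_symm]; exact f.isIso.ran_ideal, by rw [ran_symm]; exact f.isIso.dom_ideal,
    fun u v x h => (PEquiv.mem_iff_mem _).2
      (f.isIso.map_append v u x ((PEquiv.mem_iff_mem _).1 h))⟩
  dom_finGen := by rw [dom_symm]; exact f.ran_finGen
  dom_ess := by rw [dom_symm]; exact f.ran_ess
  ran_finGen := by rw [ran_symm]; exact f.dom_finGen
  ran_ess := by rw [ran_symm]; exact f.dom_ess

theorem comp_dom_len (f g : EssIso) :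
    ∃ N : ℕ, ∀ u : Word, N ≤ u.length → u ∈ dom (g.map.trans f.map) := by
  obtain ⟨N, hN⟩ := exists_len g.dom_finGen g.dom_ess
  obtain ⟨M, hM⟩ := exists_len f.dom_finGen f.dom_ess
  refine ⟨N + M, fun u hu => ?_⟩
  obtain ⟨v, hv⟩ := hN (u.take N) (by simp; omega)
  have h := g.isIso.map_append _ _ (u.drop N) hv
  rw [List.take_append_drop] at h
  obtain ⟨w, hw⟩ := hM (v ++ u.drop N) (by simp; omega)
  exact ⟨w, (PEquiv.mem_trans _ _ _ _).2 ⟨_, h, hw⟩⟩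

/-- The composition `f ∘ g` (apply `g` first), defined on all words `u` in the domain of `g`
such that `g u` is in the domain of `f`. -/
def comp (f g : EssIso) : EssIso :=
  ofLen (g.map.trans f.map)
    (by
      have key : ∀ u v x : Word, v ∈ (g.map.trans f.map) u →
          v ++ x ∈ (g.map.trans f.map) (u ++ x) := by
        intro u v x h
        rw [PEquiv.mem_trans] at h ⊢
        obtain ⟨w, hw, hv⟩ := h
        exact ⟨w ++ x, g.isIso.map_append _ _ _ hw, f.isIso.map_append _ _ _ hv⟩
      exact ⟨fun u ⟨v, hv⟩ x => ⟨v ++ x, key u v x hv⟩,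
        fun v ⟨u, hu⟩ x => ⟨u ++ x, key u v x hu⟩, key⟩)
    (comp_dom_len f g)
    (by
      obtain ⟨N, hN⟩ := comp_dom_len g.symm f.symm
      refine ⟨N, fun u hu => ?_⟩
      have := hN u hu
      rwa [show f.symm.map.trans g.symm.map = (g.map.trans f.map).symm from rfl,
        dom_symm] at this)

/-! ### The maximum extension -/

/-- The pair `(x, y)` is compatible with `f`: mapping `x w` to `y w` for all words `w` agrees
with `f` wherever `f` is defined. -/
def Compat (f : EssIso) (x y : Word) : Prop :=
  ∀ w z : Word, z ∈ f.map (x ++ w) → z = y ++ w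

theorem Compat.unique {f : EssIso} {x y y' : Word} (h : f.Compat x y) (h' : f.Compat x y') :
    y = y' := by
  obtain ⟨w, z, hz⟩ := f.exists_dom x
  exact List.append_cancel_right ((h w z hz).symm.trans (h' w z hz))

theorem Compat.symm {f : EssIso} {x y : Word} (h : f.Compat x y) : f.symm.Compat y x := by
  intro w z hz
  have hz' : y ++ w ∈ f.map z := (PEquiv.mem_iff_mem _).1 hz
  obtain ⟨v, t, ht⟩ := f.exists_dom (x ++ w)
  have ht' : t = y ++ (w ++ v) := h (w ++ v) t (by simpa using ht)
  have h1 := f.isIso.map_append _ _ v hz'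
  rw [ht', ← List.append_assoc] at ht
  exact List.append_cancel_right (f.map.inj h1 ht)

theorem Compat.append {f : EssIso} {x y : Word} (h : f.Compat x y) (v : Word) :
    f.Compat (x ++ v) (y ++ v) := by
  intro w z hz
  rw [List.append_assoc] at hz ⊢
  exact h _ _ hz

theorem compat_of_mem {f : EssIso} {x y : Word} (h : y ∈ f.map x) : f.Compat x y := by
  intro w z hz
  exact Option.mem_unique hz (f.isIso.map_append _ _ w h)

open Classical in
/-- The word to which the maximum extension of `f` maps `x`, if there is one. -/
noncomputable def maxFun (f : EssIso) (x : Word) : Option Word :=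
  if h : ∃ y, f.Compat x y then some h.choose else none

theorem mem_maxFun {f : EssIso} {x y : Word} : y ∈ f.maxFun x ↔ f.Compat x y := by
  unfold maxFun
  split_ifs with h
  · simp only [Option.mem_def, Option.some.injEq]
    exact ⟨fun e => e ▸ h.choose_spec, fun e => h.choose_spec.unique e⟩
  · simp only [Option.mem_def, reduceCtorEq, false_iff]
    exact fun e => h ⟨y, e⟩

/-- The underlying partial bijection of the maximum extension of `f`. -/
noncomputable def maxMap (f : EssIso) : Word ≃. Word where
  toFun := f.maxFun
  invFun := f.symm.maxFun
  inv x y := by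
    rw [← Option.mem_def, ← Option.mem_def, mem_maxFun, mem_maxFun]
    exact ⟨fun h => h.symm, fun h => h.symm⟩

theorem mem_maxMap {f : EssIso} {x y : Word} : y ∈ f.maxMap x ↔ f.Compat x y :=
  mem_maxFun

theorem le_maxMap (f : EssIso) : f.map ≤ f.maxMap :=
  fun _ _ h => mem_maxMap.2 (compat_of_mem h)

theorem isIso_maxMap (f : EssIso) : IsRightIdealIso f.maxMap := by
  have key : ∀ u v x : Word, v ∈ f.maxMap u → v ++ x ∈ f.maxMap (u ++ x) := by
    intro u v x h
    rw [mem_maxMap] at h ⊢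
    exact h.append x
  exact ⟨fun u ⟨v, hv⟩ x => ⟨v ++ x, key u v x hv⟩,
    fun v ⟨u, hu⟩ x => ⟨u ++ x, key u v x hu⟩, key⟩

/-- The maximum extension of `f`. -/
noncomputable def max (f : EssIso) : EssIso :=
  ofLen f.maxMap f.isIso_maxMap
    ((exists_len f.dom_finGen f.dom_ess).imp fun _ h u hu =>
      (h u hu).imp fun _ hv => f.le_maxMap _ _ hv)
    ((exists_len f.ran_finGen f.ran_ess).imp fun _ h u hu =>
      (h u hu).imp fun _ hv => f.le_maxMap _ _ hv)

/-- `f.max` is indeed the greatest right-ideal isomorphism that extends `f`. -/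
theorem isGreatest_max (f : EssIso) :
    IsGreatest {g : Word ≃. Word | IsRightIdealIso g ∧ f.map ≤ g} f.max.map := by
  refine ⟨⟨f.isIso_maxMap, f.le_maxMap⟩, ?_⟩
  rintro g ⟨hg, hfg⟩ x y hxy
  refine mem_maxMap.2 fun w z hz => ?_
  exact Option.mem_unique (hfg _ _ hz) (hg.map_append _ _ w hxy)

theorem isMaximal_max (f : EssIso) : IsMaximal f.max.map := by
  intro g hg hle
  exact le_antisymm (f.isGreatest_max.2 ⟨hg, f.isGreatest_max.1.2.trans hle⟩) hle

theorem max_eq_self {f : EssIso} (hf : IsMaximal f.map) : f.max = f :=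
  ext_map (hf _ f.max.isIso f.isGreatest_max.1.2)

/-- Two isomorphisms agree on all sufficiently long words. -/
def Agree (f g : EssIso) : Prop :=
  ∃ N : ℕ, ∀ u : Word, N ≤ u.length → f.map u = g.map u

theorem Agree.symm {f g : EssIso} (h : Agree f g) : Agree g f :=
  h.imp fun _ h u hu => (h u hu).symm

theorem agree_of_le {f g : EssIso} (h : f.map ≤ g.map) : Agree f g := by
  obtain ⟨N, hN⟩ := exists_len f.dom_finGen f.dom_ess
  refine ⟨N, fun u hu => ?_⟩
  obtain ⟨v, hv⟩ := hN u hu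
  exact (Option.mem_def.1 hv).trans (Option.mem_def.1 (h _ _ hv)).symm

theorem agree_max (f : EssIso) : Agree f f.max := agree_of_le f.le_maxMap

theorem Agree.compat {f g : EssIso} (h : Agree f g) {x y : Word} (hx : f.Compat x y) :
    g.Compat x y := by
  obtain ⟨N, hN⟩ := h
  intro w z hz
  have h1 := g.isIso.map_append _ _ (List.replicate N a) hz
  rw [← hN _ (by simp; omega), List.append_assoc] at h1
  have h2 := hx _ _ h1
  rw [← List.append_assoc] at h2
  exact List.append_cancel_right h2

theorem Agree.max_eq {f g : EssIso} (h : Agree f g) : f.max = g.max := by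
  apply ext_map
  refine le_antisymm ?_ ?_
  · exact fun x y hxy => mem_maxMap.2 (h.compat (mem_maxMap.1 hxy))
  · exact fun x y hxy => mem_maxMap.2 (h.symm.compat (mem_maxMap.1 hxy))

theorem agree_comp_right (f : EssIso) {g g' : EssIso} (h : Agree g g') :
    Agree (f.comp g) (f.comp g') := by
  obtain ⟨N, hN⟩ := h
  refine ⟨N, fun u hu => ?_⟩
  change (g.map u).bind f.map = (g'.map u).bind f.map
  rw [hN u hu]

theorem agree_comp_left {f f' : EssIso} (g : EssIso) (h : Agree f f') :
    Agree (f.comp g) (f'.comp g) := by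
  obtain ⟨N, hN⟩ := h
  obtain ⟨M, hM⟩ := exists_len g.dom_finGen g.dom_ess
  refine ⟨M + N, fun u hu => ?_⟩
  obtain ⟨v, hv⟩ := hM (u.take M) (by simp; omega)
  have h := g.isIso.map_append _ _ (u.drop M) hv
  rw [List.take_append_drop, Option.mem_def] at h
  change (g.map u).bind f.map = (g.map u).bind f'.map
  rw [h]
  exact hN _ (by simp; omega)

theorem comp_assoc (f g h : EssIso) : (f.comp g).comp h = f.comp (g.comp h) :=
  ext_map (PEquiv.trans_assoc h.map g.map f.map).symm

theorem agree_symm_comp (f : EssIso) : Agree (f.symm.comp f) id := by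
  refine agree_of_le fun x y hxy => ?_
  obtain ⟨z, hz, hy⟩ := (PEquiv.mem_trans _ _ _ _).1 hxy
  have hy' : z ∈ f.map y := (PEquiv.mem_iff_mem _).1 hy
  rw [f.map.inj hz hy']
  exact Option.mem_def.2 rfl

theorem isMaximal_id : IsMaximal id.map := by
  intro g hg hle
  refine le_antisymm (fun x y hxy => ?_) hle
  have : x ∈ g x := hle x x (Option.mem_def.2 rfl)
  rw [Option.mem_unique hxy this]
  exact Option.mem_def.2 rfl

theorem isMaximal_symm {f : EssIso} (hf : IsMaximal f.map) : IsMaximal f.symm.map := by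
  have h : f.symm.max.symm.map = f.map := by
    refine hf _ f.symm.max.symm.isIso fun x y hxy => ?_
    exact (PEquiv.mem_iff_mem _).2 (f.symm.le_maxMap _ _ ((PEquiv.mem_iff_mem _).2 hxy))
  have h' : f.symm.max.map = f.symm.map := by
    have := congrArg PEquiv.symm h
    exact this
  have h2 := isMaximal_max f.symm
  rwa [h'] at h2

end EssIso

/-! ## The Thompson group -/

/-- The Thompson group `V`: all maximal isomorphisms between finitely generated essential right
ideals of `{a, b}*`. -/
def V : Type := {f : EssIso // IsMaximal f.map}

namespace V

/-- The partial bijection of `{a, b}*` given by an element of `V`; `g.act u = some v` says that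
`g` is defined at `u` with value `v`. -/
def act (g : V) (u : Word) : Option Word := g.1.map u

/-- The product is the maximum extension of the composition (the right factor is applied
first). -/
noncomputable instance : Mul V := ⟨fun f g => ⟨(f.1.comp g.1).max, EssIso.isMaximal_max _⟩⟩

instance : One V := ⟨⟨EssIso.id, EssIso.isMaximal_id⟩⟩

instance : Inv V := ⟨fun f => ⟨f.1.symm, EssIso.isMaximal_symm f.2⟩⟩

noncomputable instance : Group V :=
  Group.ofLeftAxioms
    (by
      intro f g h
      apply Subtype.ext
      change (((f.1.comp g.1).max).comp h.1).max = (f.1.comp ((g.1.comp h.1).max)).max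
      rw [(EssIso.agree_comp_left h.1 (EssIso.agree_max (f.1.comp g.1)).symm).max_eq,
        (EssIso.agree_comp_right f.1 (EssIso.agree_max (g.1.comp h.1)).symm).max_eq,
        EssIso.comp_assoc])
    (by
      intro f
      apply Subtype.ext
      change (EssIso.id.comp f.1).max = f.1
      have : EssIso.id.comp f.1 = f.1 := EssIso.ext_map (PEquiv.trans_refl f.1.map)
      rw [this, EssIso.max_eq_self f.2])
    (by
      intro f
      apply Subtype.ext
      change (f.1.symm.comp f.1).max = EssIso.id
      rw [(EssIso.agree_symm_comp f.1).max_eq, EssIso.max_eq_self EssIso.isMaximal_id])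

/-- `g` is the isomorphism with table `T`: it maps `u x` to `v x` for the entries `(u, v)` of `T`
and all words `x`, and is not defined on any other word. -/
def HasTable (g : V) (T : List (Word × Word)) : Prop :=
  ∀ s t : Word, g.act s = some t ↔ ∃ p ∈ T, ∃ x : Word, s = p.1 ++ x ∧ t = p.2 ++ x

/-- `g = φ_a`: `g (a x) = a φ(x)` for all `x` in the domain of `φ`, and `g (b) = b`. -/
def IsCopyA (φ g : V) : Prop :=
  (∀ x y : Word, φ.act x = some y → g.act ([a] ++ x) = some ([a] ++ y)) ∧
    g.act [b] = some [b]

/-- `g = φ_b`: `g (b x) = b φ(x)` for all `x` in the domain of `φ`, and `g (a) = a`. -/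
def IsCopyB (φ g : V) : Prop :=
  (∀ x y : Word, φ.act x = some y → g.act ([b] ++ x) = some ([b] ++ y)) ∧
    g.act [a] = some [a]

end V

/-- The table of `α`. -/
def tableAlpha : List (Word × Word) :=
  [([a], [b, b, b, b, a]),
   ([b, b, b], [b, b, b, a]),
   ([b, b, a, b], [b, b, a]),
   ([b, b, a, a, a], [a]),
   ([b, b, a, a, b], [b, a]),
   ([b, a], [b, b, b, b, b])]

/-- The table of `β`. -/
def tableBeta : List (Word × Word) :=
  [([b], [a, a, a, b, a]),
   ([a, b], [a, a, a, b, b]),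
   ([a, a, b, b], [a, a, b]),
   ([a, a, b, a, a], [b]),
   ([a, a, b, a, b], [a, b]),
   ([a, a, a], [a, a, a, a])]

end Thompson

/-! ## Distortion of subgroups -/

namespace Distortion

/-- The `A`-length of `g`: the least length of a sequence of elements of `A ∪ A⁻¹` with
product `g`. It is used only for `g` in the subgroup generated by `A`. -/
noncomputable def wordLength {G : Type*} [Group G] (A : Set G) (g : G) : ℕ :=
  sInf {n | ∃ l : List G, (∀ x ∈ l, x ∈ A ∨ x⁻¹ ∈ A) ∧ l.prod = g ∧ l.length = n}

/-- `f` is a distortion function of the subgroup `⟨X⟩` of the group generated by `A`. -/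
def IsDistortionFunction {G : Type*} [Group G] (A X : Set G) (f : ℕ → ℕ) : Prop :=
  Monotone f ∧ ∀ g ∈ Subgroup.closure X, wordLength X g ≤ f (wordLength A g)

/-- Linear equivalence of functions. -/
def LinearlyEquivalent (f₁ f₂ : ℕ → ℕ) : Prop :=
  ∃ c₀ C₁₂ c₁₂ C₂₁ c₂₁ : ℕ, 0 < c₀ ∧ 0 < C₁₂ ∧ 0 < c₁₂ ∧ 0 < C₂₁ ∧ 0 < c₂₁ ∧
    ∀ n ≥ c₀, f₁ n ≤ C₁₂ * f₂ (c₁₂ * n) ∧ f₂ n ≤ C₂₁ * f₁ (c₂₁ * n)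

/-- The subgroup `H` of `G` has linear distortion: for all finite sets `A` generating `G` and
`X` generating `H`, there is a minimum distortion function, and it is linearly equivalent to
`n ↦ n`. -/
def HasLinearDistortion {G : Type*} [Group G] (H : Subgroup G) : Prop :=
  ∀ A X : Finset G, Subgroup.closure (A : Set G) = ⊤ → Subgroup.closure (X : Set G) = H →
    ∃ δ : ℕ → ℕ, IsLeast {f | IsDistortionFunction (A : Set G) (X : Set G) f} δ ∧
      LinearlyEquivalent δ (fun n => n)

end Distortion

/-! Let `stretch g` be the largest increase of length that `g` causes on words of its domain. It is
finite, since the domain is finitely generated; it vanishes at the identity and is subadditive.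
Hence it is at most a constant times the word length over any finite generating set of `V`. If the
word length of a finitely generated subgroup is conversely at most a constant times the stretch, and
the stretch grows at least linearly along some cyclic subgroup, the distortion is linear
(`hasLinearDistortion_of_subadditive`).

For `⟨α, β⟩` the converse bound is a ping-pong argument with lengths. The words `bbb`, `bba`, `aaa`,
`aab` mark regions belonging to `α`, `α⁻¹`, `β`, `β⁻¹`. Each of these four elements sends the
basepoint `ba`, and every region except that of its own inverse, into its own region, lengthening
each word by at least one letter (`exists_act_region`). A reduced word of length `n` therefore
lengthens `ba` by at least `n` (`exists_act_lift`). So its stretch is at least `n`, which gives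
freeness and undistortedness together.

For the second subgroup, `V.join` embeds `V × V` in `V` by letting the factors act behind `a` and
behind `b`. The stretch of a joined pair bounds the norm of each component, so twice the stretch
bounds the sum of the norms, hence the word length. -/

namespace Distortion

/-! ### Word length and a criterion for linear distortion -/

section

variable {G : Type*} [Group G]

theorem wordLength_le {A : Set G} {g : G} {l : List G} (hl : ∀ x ∈ l, x ∈ A ∨ x⁻¹ ∈ A)
    (h : l.prod = g) : wordLength A g ≤ l.length :=
  Nat.sInf_le ⟨l, hl, h, rfl⟩

theorem exists_list_wordLength {A : Set G} {g : G} (hg : g ∈ Subgroup.closure A) :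
    ∃ l : List G, (∀ x ∈ l, x ∈ A ∨ x⁻¹ ∈ A) ∧ l.prod = g ∧ l.length = wordLength A g := by
  rw [← Subgroup.mem_toSubmonoid, Subgroup.closure_toSubmonoid] at hg
  obtain ⟨l, hl, h⟩ := Submonoid.exists_list_of_mem_closure hg
  exact Nat.sInf_mem (s := {n | ∃ l : List G, (∀ x ∈ l, x ∈ A ∨ x⁻¹ ∈ A) ∧ l.prod = g ∧
    l.length = n}) ⟨_, l, hl, h, rfl⟩

theorem wordLength_one (A : Set G) : wordLength A 1 = 0 :=
  Nat.le_zero.1 (wordLength_le (l := []) (by simp) rfl)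

theorem wordLength_mul_le {A : Set G} {g h : G} (hg : g ∈ Subgroup.closure A)
    (hh : h ∈ Subgroup.closure A) : wordLength A (g * h) ≤ wordLength A g + wordLength A h := by
  obtain ⟨l, hl, rfl, hl'⟩ := exists_list_wordLength hg
  obtain ⟨m, hm, rfl, hm'⟩ := exists_list_wordLength hh
  rw [← hl', ← hm', ← List.length_append]
  refine wordLength_le (fun x hx => ?_) List.prod_append
  exact (List.mem_append.1 hx).elim (hl x) (hm x)

theorem wordLength_pow_le {A : Set G} {g : G} (hg : g ∈ Subgroup.closure A) (n : ℕ) :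
    wordLength A (g ^ n) ≤ wordLength A g * n := by
  induction n with
  | zero => simp [wordLength_one]
  | succ n ih =>
    rw [pow_succ, Nat.mul_succ]
    exact (wordLength_mul_le (pow_mem hg n) hg).trans (Nat.add_le_add_right ih _)

/-- A function that is subadditive on a finitely generated subgroup is bounded by a multiple of the
word length. -/
theorem exists_le_mul_wordLength {A : Set G} (hA : A.Finite) {ℓ : G → ℕ} (h1 : ℓ 1 = 0)
    (hmul : ∀ g ∈ Subgroup.closure A, ∀ h ∈ Subgroup.closure A, ℓ (g * h) ≤ ℓ g + ℓ h) :
    ∃ M : ℕ, ∀ g ∈ Subgroup.closure A, ℓ g ≤ M * wordLength A g := by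
  obtain ⟨M, hM⟩ := ((hA.union hA.inv).image ℓ).bddAbove
  refine ⟨M, fun g hg => ?_⟩
  obtain ⟨l, hl, rfl, hl'⟩ := exists_list_wordLength hg
  rw [← hl']
  clear hl' hg
  have hmem : ∀ x, (x ∈ A ∨ x⁻¹ ∈ A) → x ∈ Subgroup.closure A := fun x hx =>
    hx.elim (fun h => Subgroup.subset_closure h)
      fun h => (Subgroup.inv_mem_iff _).1 (Subgroup.subset_closure h)
  induction l with
  | nil => simp [h1]
  | cons x l ih =>
    rw [List.prod_cons, List.length_cons, Nat.mul_succ, Nat.add_comm]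
    have hx := hl x List.mem_cons_self
    have hl2 : ∀ y ∈ l, y ∈ A ∨ y⁻¹ ∈ A := fun y hy => hl y (List.mem_cons_of_mem _ hy)
    refine (hmul x (hmem x hx) _ (Subgroup.list_prod_mem _ fun y hy => hmem y (hl2 y hy))).trans
      (Nat.add_le_add (hM ⟨x, hx, rfl⟩) (ih hl2))

/-- A subgroup on which the word length is bounded by a multiple of a subadditive function of the
whole group, and on some cyclic subgroup of which this function grows at least linearly, has linear
distortion. -/
theorem hasLinearDistortion_of_subadditive {S : Set G} (hS : S.Finite) {ℓ : G → ℕ} (h1 : ℓ 1 = 0)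
    (hmul : ∀ g h, ℓ (g * h) ≤ ℓ g + ℓ h) {c : ℕ}
    (hc : ∀ g ∈ Subgroup.closure S, wordLength S g ≤ c * ℓ g)
    {h₀ : G} (hh₀ : h₀ ∈ Subgroup.closure S) (hn : ∀ n, n ≤ ℓ (h₀ ^ n)) :
    HasLinearDistortion (Subgroup.closure S) := by
  intro A X hA hX
  obtain ⟨M, hM⟩ := exists_le_mul_wordLength (A := (A : Set G)) A.finite_toSet h1
    fun g _ h _ => hmul g h
  obtain ⟨M', hM'⟩ := exists_le_mul_wordLength (A := (X : Set G)) X.finite_toSet h1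
    fun g _ h _ => hmul g h
  obtain ⟨K, hK⟩ := exists_le_mul_wordLength hS (wordLength_one (X : Set G))
    fun g hg h hh => wordLength_mul_le (hX ▸ hg) (hX ▸ hh)
  have hAmem : ∀ g, g ∈ Subgroup.closure (A : Set G) := fun g => hA ▸ Subgroup.mem_top g
  have hbound : ∀ g ∈ Subgroup.closure S,
      wordLength (X : Set G) g ≤ K * c * M * wordLength (A : Set G) g := fun g hg =>
    calc wordLength (X : Set G) g ≤ K * wordLength S g := hK g hg
      _ ≤ K * (c * (M * wordLength (A : Set G) g)) :=
        Nat.mul_le_mul_left _ ((hc g hg).trans (Nat.mul_le_mul_left _ (hM g (hAmem g))))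
      _ = K * c * M * wordLength (A : Set G) g := by ring
  -- The minimum distortion function is the supremum of the `X`-lengths of subgroup elements in the
  -- `A`-ball of radius `n`; `hbound` keeps it finite.
  let B : ℕ → Set ℕ := fun n =>
    {k | ∃ g ∈ Subgroup.closure S, wordLength (A : Set G) g ≤ n ∧ wordLength (X : Set G) g = k}
  have hB : ∀ n, K * c * M * n ∈ upperBounds (B n) := by
    rintro n _ ⟨g, hg, hgn, rfl⟩
    exact (hbound g hg).trans (Nat.mul_le_mul_left _ hgn)
  have hne : ∀ n, (B n).Nonempty := fun n =>
    ⟨_, 1, one_mem _, by simp [wordLength_one], rfl⟩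
  have hle : ∀ n, ∀ g ∈ Subgroup.closure S, wordLength (A : Set G) g ≤ n →
      wordLength (X : Set G) g ≤ sSup (B n) := fun n g hg hgn =>
    le_csSup ⟨_, hB n⟩ ⟨g, hg, hgn, rfl⟩
  have hmono : Monotone fun n => sSup (B n) := by
    intro m n hmn
    refine csSup_le (hne m) ?_
    rintro _ ⟨g, hg, hgm, rfl⟩
    exact hle n g hg (hgm.trans hmn)
  refine ⟨fun n => sSup (B n), ⟨⟨hmono, fun g hg => hle _ g (hX ▸ hg) le_rfl⟩, ?_⟩, ?_⟩
  · rintro f ⟨hf, hfX⟩ n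
    refine csSup_le (hne n) ?_
    rintro _ ⟨g, hg, hgn, rfl⟩
    exact (hfX g (hX.symm ▸ hg)).trans (hf hgn)
  -- The increments by one only make the constants positive. The lower bound is tested on `h₀ ^ n`,
  -- whose `A`-length is at most `n` times that of `h₀`.
  · refine ⟨1, K * c * M + 1, 1, M' + 1, wordLength (A : Set G) h₀ + 1, by simp, by simp, by simp,
      by simp, by simp, fun n _ => ⟨?_, ?_⟩⟩
    · refine (csSup_le (hne n) (hB n)).trans ?_
      rw [one_mul]
      exact Nat.mul_le_mul_right _ (Nat.le_succ _)
    · have hpow := pow_mem hh₀ n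
      have hA' : wordLength (A : Set G) (h₀ ^ n) ≤ (wordLength (A : Set G) h₀ + 1) * n :=
        (wordLength_pow_le (hAmem h₀) n).trans (Nat.mul_le_mul_right _ (Nat.le_succ _))
      calc n ≤ ℓ (h₀ ^ n) := hn n
        _ ≤ M' * wordLength (X : Set G) (h₀ ^ n) := hM' _ (hX.symm ▸ hpow)
        _ ≤ _ := Nat.mul_le_mul (Nat.le_succ _) (hle _ _ hpow hA')

end

end Distortion

/-! ### Reduced words as lists of generators -/

namespace FreeGroup

theorem exists_list_prod_eq_lift {ι G : Type*} [DecidableEq ι] [Group G] (f : ι → G)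
    (w : FreeGroup ι) : ∃ l : List G, (∀ x ∈ l, x ∈ Set.range f ∨ x⁻¹ ∈ Set.range f) ∧
      l.prod = lift f w ∧ l.length = w.toWord.length := by
  refine ⟨w.toWord.map fun x => cond x.2 (f x.1) (f x.1)⁻¹, ?_, ?_, by simp⟩
  · intro x hx
    obtain ⟨⟨i, s⟩, -, rfl⟩ := List.mem_map.1 hx
    cases s
    · exact Or.inr (by simp)
    · exact Or.inl (by simp)
  · rw [← lift_mk, mk_toWord]

end FreeGroup

namespace Thompson

/-! ### Isomorphisms given by tables -/

/-- The map `u x ↦ v x` for the entries `(u, v)` of `T`. -/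
def tableFun (T : List (Word × Word)) (s : Word) : Option Word :=
  (T.find? fun p => p.1.isPrefixOf s).map fun p => p.2 ++ s.drop p.1.length

/-- The first words of the entries of `T` are distinct and form a prefix code. -/
def IsCode (T : List (Word × Word)) : Prop :=
  ∀ p ∈ T, ∀ q ∈ T, p.1 <+: q.1 → p = q

/-- Every word of length `N` begins with the first word of an entry of `T`. -/
def Covers (T : List (Word × Word)) (N : ℕ) : Prop :=
  ∀ s : Word, N ≤ s.length → ∃ p ∈ T, p.1 <+: s

/-- Two prefixes of one word are comparable, so in a prefix code at most one entry applies to `s`;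
the entry that `find?` meets first is the only one. -/
theorem mem_tableFun {T : List (Word × Word)} (hT : IsCode T) {s t : Word} :
    t ∈ tableFun T s ↔ ∃ p ∈ T, ∃ x : Word, s = p.1 ++ x ∧ t = p.2 ++ x := by
  unfold tableFun
  simp only [Option.mem_def, Option.map_eq_some_iff]
  constructor
  · rintro ⟨p, hp, rfl⟩
    have hpre : p.1.isPrefixOf s := List.find?_some (p := fun p : Word × Word => p.1.isPrefixOf s) hp
    obtain ⟨x, rfl⟩ := List.isPrefixOf_iff_prefix.1 hpre
    exact ⟨p, List.mem_of_find?_eq_some hp, x, rfl, by simp⟩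
  · rintro ⟨p, hp, x, rfl, rfl⟩
    have hpre : p.1 <+: p.1 ++ x := List.prefix_append _ _
    obtain ⟨q, hq⟩ := Option.isSome_iff_exists.1
      (List.find?_isSome (p := fun q : Word × Word => q.1.isPrefixOf (p.1 ++ x)).2
        ⟨p, hp, List.isPrefixOf_iff_prefix.2 hpre⟩)
    have hqT := List.mem_of_find?_eq_some hq
    have hq' : q.1 <+: p.1 ++ x := List.isPrefixOf_iff_prefix.1
      (List.find?_some (p := fun q : Word × Word => q.1.isPrefixOf (p.1 ++ x)) hq)
    have : q = p := by
      rcases le_total q.1.length p.1.length with h | h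
      · exact hT q hqT p hp (List.prefix_of_prefix_length_le hq' hpre h)
      · exact (hT p hp q hqT (List.prefix_of_prefix_length_le hpre hq' h)).symm
    subst this
    exact ⟨q, hq, by simp⟩

/-- The partial bijection with a table whose two columns are prefix codes. -/
def tableMap (T : List (Word × Word)) (h₁ : IsCode T) (h₂ : IsCode (T.map Prod.swap)) :
    Word ≃. Word where
  toFun := tableFun T
  invFun := tableFun (T.map Prod.swap)
  inv s t := by
    rw [← Option.mem_def, ← Option.mem_def, mem_tableFun h₁, mem_tableFun h₂]
    constructor
    · rintro ⟨p, hp, x, h, h'⟩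
      obtain ⟨q, hq, rfl⟩ := List.mem_map.1 hp
      exact ⟨q, hq, x, h', h⟩
    · rintro ⟨p, hp, x, h, h'⟩
      exact ⟨p.swap, List.mem_map_of_mem hp, x, h', h⟩

theorem mem_tableMap {T : List (Word × Word)} {h₁ : IsCode T} {h₂ : IsCode (T.map Prod.swap)}
    {s t : Word} :
    t ∈ tableMap T h₁ h₂ s ↔ ∃ p ∈ T, ∃ x : Word, s = p.1 ++ x ∧ t = p.2 ++ x :=
  mem_tableFun h₁

theorem isRightIdealIso_tableMap {T : List (Word × Word)} (h₁ : IsCode T)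
    (h₂ : IsCode (T.map Prod.swap)) : IsRightIdealIso (tableMap T h₁ h₂) := by
  have key : ∀ u v x : Word, v ∈ tableMap T h₁ h₂ u → v ++ x ∈ tableMap T h₁ h₂ (u ++ x) := by
    intro u v x h
    rw [mem_tableMap] at h ⊢
    obtain ⟨p, hp, y, rfl, rfl⟩ := h
    exact ⟨p, hp, y ++ x, by simp, by simp⟩
  exact ⟨fun u ⟨v, hv⟩ x => ⟨v ++ x, key u v x hv⟩, fun v ⟨u, hu⟩ x => ⟨u ++ x, key u v x hu⟩, key⟩

/-- The isomorphism with a table whose two columns are finite maximal prefix codes. -/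
def tableIso (T : List (Word × Word)) (h₁ : IsCode T) (h₂ : IsCode (T.map Prod.swap)) {N M : ℕ}
    (hN : Covers T N) (hM : Covers (T.map Prod.swap) M) : EssIso :=
  EssIso.ofLen (tableMap T h₁ h₂) (isRightIdealIso_tableMap h₁ h₂)
    ⟨N, fun u hu => by
      obtain ⟨p, hp, x, rfl⟩ := hN u hu
      exact ⟨p.2 ++ x, mem_tableMap.2 ⟨p, hp, x, rfl, rfl⟩⟩⟩
    ⟨M, fun u hu => by
      obtain ⟨_, hq, x, rfl⟩ := hM u hu
      obtain ⟨p, hp, rfl⟩ := List.mem_map.1 hq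
      exact ⟨p.1 ++ x, mem_tableMap.2 ⟨p, hp, x, rfl, rfl⟩⟩⟩

/-- Every word outside the domain has two extensions in the domain that change length
differently. -/
def IsLengthReduced (T : List (Word × Word)) : Prop :=
  ∀ s : Word, (∃ p ∈ T, p.1 <+: s) ∨
    ∃ p ∈ T, ∃ q ∈ T, s <+: p.1 ∧ s <+: q.1 ∧
      p.2.length + q.1.length ≠ q.2.length + p.1.length

/-- A right-ideal isomorphism defined at `s` changes the length of every extension of `s` by the
same amount. Two extensions with different changes thus prevent any value at `s`. -/
theorem isMaximal_tableMap {T : List (Word × Word)} {h₁ : IsCode T}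
    {h₂ : IsCode (T.map Prod.swap)} (hT : IsLengthReduced T) : IsMaximal (tableMap T h₁ h₂) := by
  intro g hg hle
  refine le_antisymm (fun s t hst => ?_) hle
  have hp : ∀ p ∈ T, p.2 ∈ g p.1 := fun p hp =>
    hle _ _ (mem_tableMap.2 ⟨p, hp, [], by simp, by simp⟩)
  rcases hT s with ⟨p, hpT, x, rfl⟩ | ⟨p, hpT, q, hqT, ⟨x, hx⟩, ⟨y, hy⟩, hne⟩
  · rw [Option.mem_unique hst (hg.map_append _ _ x (hp p hpT))]
    exact mem_tableMap.2 ⟨p, hpT, x, rfl, rfl⟩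
  · have e₁ : t ++ x = p.2 := Option.mem_unique (hg.map_append _ _ x hst) (hx ▸ hp p hpT)
    have e₂ : t ++ y = q.2 := Option.mem_unique (hg.map_append _ _ y hst) (hy ▸ hp q hqT)
    rw [← hx, ← hy, ← e₁, ← e₂] at hne
    simp only [List.length_append] at hne
    omega

/-- Five is the greatest length of a word in either column of both tables, so checking the 32 words
of that length suffices. -/
theorem covers_of_forall {T : List (Word × Word)}
    (h : ∀ c₁ c₂ c₃ c₄ c₅ : Letter, ∃ p ∈ T, p.1 <+: [c₁, c₂, c₃, c₄, c₅]) : Covers T 5 := by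
  intro s hs
  match s, hs with
  | c₁ :: c₂ :: c₃ :: c₄ :: c₅ :: x, _ =>
    obtain ⟨p, hp, hpre⟩ := h c₁ c₂ c₃ c₄ c₅
    exact ⟨p, hp, hpre.trans ⟨x, rfl⟩⟩

instance (T : List (Word × Word)) : Decidable (IsCode T) := by unfold IsCode; infer_instance

theorem isLengthReduced_tableAlpha : IsLengthReduced tableAlpha := by
  intro s
  by_cases hs : 5 ≤ s.length
  · exact Or.inl (covers_of_forall (by decide) s hs)
  · match s with
    | [] => decide
    | [c₁] => revert c₁; decide
    | [c₁, c₂] => revert c₁ c₂; decide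
    | [c₁, c₂, c₃] => revert c₁ c₂ c₃; decide
    | [c₁, c₂, c₃, c₄] => revert c₁ c₂ c₃ c₄; decide
    | _ :: _ :: _ :: _ :: _ :: _ => simp at hs

theorem isLengthReduced_tableBeta : IsLengthReduced tableBeta := by
  intro s
  by_cases hs : 5 ≤ s.length
  · exact Or.inl (covers_of_forall (by decide) s hs)
  · match s with
    | [] => decide
    | [c₁] => revert c₁; decide
    | [c₁, c₂] => revert c₁ c₂; decide
    | [c₁, c₂, c₃] => revert c₁ c₂ c₃; decide
    | [c₁, c₂, c₃, c₄] => revert c₁ c₂ c₃ c₄; decide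
    | _ :: _ :: _ :: _ :: _ :: _ => simp at hs

theorem exists_hasTable_tableAlpha : ∃ g : V, g.HasTable tableAlpha :=
  have h₁ : IsCode tableAlpha := by decide
  have h₂ : IsCode (tableAlpha.map Prod.swap) := by decide
  ⟨⟨tableIso tableAlpha h₁ h₂ (covers_of_forall (by decide)) (covers_of_forall (by decide)),
      isMaximal_tableMap (h₁ := h₁) (h₂ := h₂) isLengthReduced_tableAlpha⟩,
    fun _ _ => mem_tableMap (h₁ := h₁) (h₂ := h₂)⟩

theorem exists_hasTable_tableBeta : ∃ g : V, g.HasTable tableBeta :=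
  have h₁ : IsCode tableBeta := by decide
  have h₂ : IsCode (tableBeta.map Prod.swap) := by decide
  ⟨⟨tableIso tableBeta h₁ h₂ (covers_of_forall (by decide)) (covers_of_forall (by decide)),
      isMaximal_tableMap (h₁ := h₁) (h₂ := h₂) isLengthReduced_tableBeta⟩,
    fun _ _ => mem_tableMap (h₁ := h₁) (h₂ := h₂)⟩

/-! ### The action of products and inverses -/

namespace V

theorem act_append {g : V} {u v : Word} (h : g.act u = some v) (x : Word) :
    g.act (u ++ x) = some (v ++ x) :=
  g.1.isIso.map_append u v x h

theorem act_one (u : Word) : (1 : V).act u = some u := rfl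

theorem act_mul {g h : V} {u v w : Word} (hv : h.act u = some v) (hw : g.act v = some w) :
    (g * h).act u = some w :=
  (g.1.comp h.1).le_maxMap u w ((PEquiv.mem_trans _ _ _ _).2 ⟨v, hv, hw⟩)

theorem act_inv {g : V} {u v : Word} (h : g.act u = some v) : g⁻¹.act v = some u :=
  (PEquiv.mem_iff_mem g.1.map).2 h

/-- The words in the domain of `g` lengthen by at most `k`. -/
def StretchLE (g : V) (k : ℕ) : Prop :=
  ∀ u v : Word, g.act u = some v → v.length ≤ u.length + k

/-- The change of length is constant on `c ++ x` for each generator `c` of the domain, and there are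
finitely many generators. -/
theorem exists_stretchLE (g : V) : ∃ k, g.StretchLE k := by
  obtain ⟨C, hC, hdom⟩ := g.1.dom_finGen
  -- The default `[]` is never used, because every generator lies in the domain.
  obtain ⟨k, hk⟩ := (hC.image fun c => ((g.act c).getD []).length).bddAbove
  refine ⟨k, fun u v huv => ?_⟩
  have hu : u ∈ dom g.1.map := ⟨v, huv⟩
  rw [hdom] at hu
  obtain ⟨c, hc, x, rfl⟩ := hu
  have hc' : c ∈ dom g.1.map := hdom ▸ ⟨c, hc, [], by simp⟩
  obtain ⟨d, hd⟩ := hc'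
  have hd' : g.act c = some d := hd
  have := hk ⟨c, hc, rfl⟩
  rw [act_append hd' x, Option.some.injEq] at huv
  simp only [hd', Option.getD_some] at this
  rw [← huv]
  simp only [List.length_append]
  omega

/-- The product may be defined at `u` where the plain composition is not. Appending a suitable `x`
brings `u` into the domain of the composition without affecting the change of length. -/
theorem StretchLE.mul {g h : V} {k l : ℕ} (hg : g.StretchLE k) (hh : h.StretchLE l) :
    (g * h).StretchLE (k + l) := by
  intro u v huv
  obtain ⟨x, w, hw⟩ := (g.1.comp h.1).exists_dom u
  obtain ⟨z, hz, hzw⟩ := (PEquiv.mem_trans _ _ _ _).1 hw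
  have e : w = v ++ x :=
    Option.some.inj ((act_mul (g := g) hz hzw).symm.trans (act_append huv x))
  have h₁ := hh _ _ hz
  have h₂ := hg _ _ hzw
  rw [e] at h₂
  simp only [List.length_append] at h₁ h₂
  omega

/-- The largest increase of length of a word under `g`. -/
noncomputable def stretch (g : V) : ℕ := sInf {k | g.StretchLE k}

theorem stretchLE_stretch (g : V) : g.StretchLE g.stretch :=
  Nat.sInf_mem (s := {k | g.StretchLE k}) g.exists_stretchLE

theorem stretch_one : stretch 1 = 0 :=
  Nat.le_zero.1 (Nat.sInf_le fun u v h => by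
    rw [act_one, Option.some.injEq] at h
    rw [h]; exact le_rfl)

theorem stretch_mul_le (g h : V) : stretch (g * h) ≤ stretch g + stretch h :=
  Nat.sInf_le (g.stretchLE_stretch.mul h.stretchLE_stretch)

theorem le_stretch {g : V} {u v : Word} (h : g.act u = some v) {n : ℕ}
    (hn : u.length + n ≤ v.length) : n ≤ g.stretch :=
  Nat.le_of_add_le_add_left (hn.trans (g.stretchLE_stretch u v h))

end V

/-! ### Ping-pong -/

/-- The beginning of the words that arise when a reduced word over `α^±1`, `β^±1` is applied whose
first letter is `p`. -/
def region (p : Fin 2 × Bool) : Word :=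
  match p with
  | (0, true) => [b, b, b]
  | (0, false) => [b, b, a]
  | (1, true) => [a, a, a]
  | (1, false) => [a, a, b]

variable {α β : V}

/-- Each of `α^±1`, `β^±1` maps the basepoint and the regions other than that of its inverse into
its own region, and makes words longer. -/
theorem exists_act_region (hα : α.HasTable tableAlpha) (hβ : β.HasTable tableBeta)
    (p : Fin 2 × Bool) (r : Word)
    (hr : r = [b, a] ∨ ∃ q : Fin 2 × Bool, (p.1 = q.1 → p.2 = q.2) ∧ r = region q) (x : Word) :
    ∃ z, (cond p.2 (![α, β] p.1) (![α, β] p.1)⁻¹).act (r ++ x) = some (region p ++ z) ∧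
      (r ++ x).length + 1 ≤ (region p ++ z).length := by
  have A : ∀ e ∈ tableAlpha, ∀ y, α.act (e.1 ++ y) = some (e.2 ++ y) := fun e he y =>
    (hα _ _).2 ⟨e, he, y, rfl, rfl⟩
  have B : ∀ e ∈ tableBeta, ∀ y, β.act (e.1 ++ y) = some (e.2 ++ y) := fun e he y =>
    (hβ _ _).2 ⟨e, he, y, rfl, rfl⟩
  have A' : ∀ e ∈ tableAlpha, ∀ y, α⁻¹.act (e.2 ++ y) = some (e.1 ++ y) := fun e he y =>
    V.act_inv (A e he y)
  have B' : ∀ e ∈ tableBeta, ∀ y, β⁻¹.act (e.2 ++ y) = some (e.1 ++ y) := fun e he y =>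
    V.act_inv (B e he y)
  -- This splits the four facts into one rewrite rule per table entry, with which the cases below
  -- compute.
  simp only [tableAlpha, tableBeta, List.mem_cons, List.not_mem_nil, or_false, forall_eq_or_imp,
    forall_eq, List.cons_append, List.nil_append] at A B A' B'
  obtain ⟨i, s⟩ := p
  rcases hr with rfl | ⟨⟨j, t⟩, hq, rfl⟩
  · fin_cases i <;> cases s <;> simp [region, A, B, A', B'] <;> omega
  · fin_cases i <;> cases s <;> fin_cases j <;> cases t <;>
      simp [region, A, B, A', B'] at hq ⊢ <;> omega

/-- Induction on the reduced word, whose leftmost letter acts last: the image of `ba` stays in the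
region of that letter, or is `ba` itself for the empty word. -/
theorem exists_act_lift (hα : α.HasTable tableAlpha) (hβ : β.HasTable tableBeta)
    (w : FreeGroup (Fin 2)) :
    ∃ y, (FreeGroup.lift ![α, β] w).act [b, a] = some y ∧
      [b, a].length + w.norm ≤ y.length := by
  have key : ∀ l : List (Fin 2 × Bool), FreeGroup.IsReduced l →
      ∃ r x, (FreeGroup.lift ![α, β] (FreeGroup.mk l)).act [b, a] = some (r ++ x) ∧
        [b, a].length + l.length ≤ (r ++ x).length ∧
        (l = [] ∧ r = [b, a] ∨ ∃ q, l.head? = some q ∧ r = region q) := by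
    intro l
    induction l with
    | nil => exact fun _ => ⟨[b, a], [], V.act_one _, by simp, Or.inl ⟨rfl, rfl⟩⟩
    | cons p l ih =>
      intro hl
      obtain ⟨r, x, hact, hlen, hr⟩ := ih (hl.infix (List.suffix_cons p l).isInfix)
      -- Reducedness says that neighbouring letters on the same generator have the same sign, which
      -- excludes exactly the region of the inverse.
      have hr' : r = [b, a] ∨ ∃ q : Fin 2 × Bool, (p.1 = q.1 → p.2 = q.2) ∧ r = region q := by
        rcases hr with ⟨-, h⟩ | ⟨q, hq, h⟩
        · exact Or.inl h
        · obtain ⟨l', rfl⟩ := List.head?_eq_some_iff.1 hq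
          exact Or.inr ⟨q, (FreeGroup.isReduced_cons_cons.1 hl).1, h⟩
      obtain ⟨z, hz, hlen'⟩ := exists_act_region hα hβ p r hr' x
      refine ⟨region p, z, ?_, ?_, Or.inr ⟨p, rfl, rfl⟩⟩
      · rw [FreeGroup.lift_mk, List.map_cons, List.prod_cons, ← FreeGroup.lift_mk]
        exact V.act_mul hact hz
      · rw [List.length_cons (as := l)]
        omega
  obtain ⟨r, x, hact, hlen, -⟩ := key w.toWord FreeGroup.isReduced_toWord
  rw [FreeGroup.mk_toWord] at hact
  exact ⟨_, hact, hlen⟩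

/-! ### Joining two elements -/

namespace EssIso

/-- The map that acts as `f` behind the first letter `a` and as `g` behind the first letter `b`. -/
def joinMap (f g : Word ≃. Word) : Word ≃. Word where
  toFun
    | [] => none
    | false :: x => (f x).map (List.cons false)
    | true :: x => (g x).map (List.cons true)
  invFun
    | [] => none
    | false :: x => (f.symm x).map (List.cons false)
    | true :: x => (g.symm x).map (List.cons true)
  inv s t := by
    rcases s with _ | ⟨_ | _, s⟩ <;> rcases t with _ | ⟨_ | _, t⟩ <;>
      simp [PEquiv.eq_some_iff]

theorem joinMap_apply (f g : Word ≃. Word) (c : Letter) (x : Word) :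
    joinMap f g (c :: x) = ((cond c g f) x).map (List.cons c) := by
  cases c <;> rfl

theorem mem_joinMap {f g : Word ≃. Word} {s t : Word} :
    t ∈ joinMap f g s ↔ ∃ c x y, s = c :: x ∧ t = c :: y ∧ y ∈ (cond c g f) x := by
  constructor
  · intro h
    rcases s with _ | ⟨c, s⟩
    · cases h
    · rw [joinMap_apply] at h
      obtain ⟨y, hy, rfl⟩ := Option.map_eq_some_iff.1 h
      exact ⟨c, s, y, rfl, rfl, hy⟩
  · rintro ⟨c, x, y, rfl, rfl, h⟩
    rw [joinMap_apply]
    exact Option.map_eq_some_iff.2 ⟨y, h, rfl⟩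

theorem isRightIdealIso_joinMap {f g : Word ≃. Word} (hf : IsRightIdealIso f)
    (hg : IsRightIdealIso g) : IsRightIdealIso (joinMap f g) := by
  have key : ∀ u v x : Word, v ∈ joinMap f g u → v ++ x ∈ joinMap f g (u ++ x) := by
    intro u v x h
    rw [mem_joinMap] at h ⊢
    obtain ⟨c, y, z, rfl, rfl, h⟩ := h
    refine ⟨c, y ++ x, z ++ x, rfl, rfl, ?_⟩
    cases c
    · exact hf.map_append _ _ _ h
    · exact hg.map_append _ _ _ h
  exact ⟨fun u ⟨v, hv⟩ x => ⟨v ++ x, key u v x hv⟩, fun v ⟨u, hu⟩ x => ⟨u ++ x, key u v x hu⟩, key⟩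

theorem exists_len_joinMap (f g : EssIso) :
    ∃ N : ℕ, ∀ u : Word, N ≤ u.length → u ∈ dom (joinMap f.map g.map) := by
  obtain ⟨N, hN⟩ := exists_len f.dom_finGen f.dom_ess
  obtain ⟨M, hM⟩ := exists_len g.dom_finGen g.dom_ess
  refine ⟨N + M + 1, fun u hu => ?_⟩
  rcases u with _ | ⟨_ | _, u⟩
  · simp at hu
  · rw [List.length_cons] at hu
    obtain ⟨v, hv⟩ := hN u (by omega)
    exact ⟨false :: v, mem_joinMap.2 ⟨_, _, _, rfl, rfl, hv⟩⟩
  · rw [List.length_cons] at hu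
    obtain ⟨v, hv⟩ := hM u (by omega)
    exact ⟨true :: v, mem_joinMap.2 ⟨_, _, _, rfl, rfl, hv⟩⟩

/-- The isomorphism that acts as `f` behind the first letter `a` and as `g` behind the first
letter `b`. -/
def join (f g : EssIso) : EssIso :=
  ofLen (joinMap f.map g.map) (isRightIdealIso_joinMap f.isIso g.isIso) (exists_len_joinMap f g)
    ((exists_len_joinMap f.symm g.symm).imp fun N hN u hu => by
      have := hN u hu
      rwa [show joinMap f.symm.map g.symm.map = (joinMap f.map g.map).symm from rfl,
        dom_symm] at this)

/-- Maximum extensions depend only on the values at long words, so this allows `max` to be inserted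
or removed inside a join. -/
theorem Agree.join {f f' g g' : EssIso} (hf : Agree f f') (hg : Agree g g') :
    Agree (f.join g) (f'.join g') := by
  obtain ⟨N, hN⟩ := hf
  obtain ⟨M, hM⟩ := hg
  refine ⟨N + M + 1, fun u hu => ?_⟩
  change joinMap f.map g.map u = joinMap f'.map g'.map u
  rcases u with _ | ⟨_ | _, u⟩
  · simp at hu
  · rw [List.length_cons] at hu
    simp only [joinMap_apply, cond_false, hN u (by omega)]
  · rw [List.length_cons] at hu
    simp only [joinMap_apply, cond_true, hM u (by omega)]

theorem comp_join (f f' g g' : EssIso) :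
    (f.join g).comp (f'.join g') = (f.comp f').join (g.comp g') := by
  refine ext_map (PEquiv.ext fun u => ?_)
  change (joinMap f'.map g'.map u).bind (joinMap f.map g.map) =
    joinMap (f'.map.trans f.map) (g'.map.trans g.map) u
  rcases u with _ | ⟨_ | _, u⟩
  · rfl
  · simp only [joinMap_apply, cond_false, Option.bind_map]
    change _ = ((f'.map u).bind f.map).map _
    rw [Option.map_bind]
    rfl
  · simp only [joinMap_apply, cond_true, Option.bind_map]
    change _ = ((g'.map u).bind g.map).map _
    rw [Option.map_bind]
    rfl

/-- Equality fails: the joined map is undefined at the empty word. This is why `V.join` has to pass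
to the maximum extension. -/
theorem agree_join_id : Agree (id.join id) id := by
  refine agree_of_le fun s t h => ?_
  obtain ⟨c, x, y, rfl, rfl, hy⟩ := mem_joinMap.1 h
  have : x = y := by cases c <;> exact Option.some.inj hy
  rw [this]
  exact Option.mem_def.2 rfl

end EssIso

namespace V

/-- The homomorphism that sends `(φ, ψ)` to the element acting as `φ` behind the first letter `a`
and as `ψ` behind the first letter `b`. -/
noncomputable def join : V × V →* V where
  toFun φ := ⟨(φ.1.1.join φ.2.1).max, EssIso.isMaximal_max _⟩
  map_one' := Subtype.ext <| by
    change (EssIso.id.join EssIso.id).max = EssIso.id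
    rw [EssIso.agree_join_id.max_eq, EssIso.max_eq_self EssIso.isMaximal_id]
  map_mul' φ ψ := Subtype.ext <| by
    change ((φ.1.1.comp ψ.1.1).max.join (φ.2.1.comp ψ.2.1).max).max =
      ((φ.1.1.join φ.2.1).max.comp (ψ.1.1.join ψ.2.1).max).max
    -- All inner maxima are removed, leaving the exact identity `comp_join` under one outer `max`.
    rw [((EssIso.agree_max (φ.1.1.comp ψ.1.1)).symm.join
        (EssIso.agree_max (φ.2.1.comp ψ.2.1)).symm).max_eq,
      (EssIso.agree_comp_left _ (EssIso.agree_max (φ.1.1.join φ.2.1)).symm).max_eq,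
      (EssIso.agree_comp_right _ (EssIso.agree_max (ψ.1.1.join ψ.2.1)).symm).max_eq,
      EssIso.comp_join]

theorem act_join_a {φ ψ : V} {x y : Word} (h : φ.act x = some y) :
    (join (φ, ψ)).act (a :: x) = some (a :: y) :=
  (φ.1.join ψ.1).le_maxMap _ _ (EssIso.mem_joinMap.2 ⟨a, x, y, rfl, rfl, h⟩)

theorem act_join_b {φ ψ : V} {x y : Word} (h : ψ.act x = some y) :
    (join (φ, ψ)).act (b :: x) = some (b :: y) :=
  (φ.1.join ψ.1).le_maxMap _ _ (EssIso.mem_joinMap.2 ⟨b, x, y, rfl, rfl, h⟩)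

theorem isCopyA_join (φ : V) : IsCopyA φ (join (φ, 1)) :=
  ⟨fun _ _ h => act_join_a h, act_join_b (act_one [])⟩

theorem isCopyB_join (φ : V) : IsCopyB φ (join (1, φ)) :=
  ⟨fun _ _ h => act_join_b h, act_join_a (act_one [])⟩

end V

/-! ### Norms, stretch and the two embeddings -/

open FreeGroup (lift of)

variable {α β : V}

theorem norm_le_stretch_lift (hα : α.HasTable tableAlpha) (hβ : β.HasTable tableBeta)
    (w : FreeGroup (Fin 2)) : w.norm ≤ (lift ![α, β] w).stretch :=
  let ⟨_, hy, hn⟩ := exists_act_lift hα hβ w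
  V.le_stretch hy hn

theorem norm_le_stretch_join_left (hα : α.HasTable tableAlpha) (hβ : β.HasTable tableBeta)
    (w : FreeGroup (Fin 2)) (g : V) : w.norm ≤ (V.join (lift ![α, β] w, g)).stretch := by
  obtain ⟨y, hy, hn⟩ := exists_act_lift hα hβ w
  refine V.le_stretch (V.act_join_a hy) ?_
  rw [List.length_cons, List.length_cons (as := y)]
  omega

theorem norm_le_stretch_join_right (hα : α.HasTable tableAlpha) (hβ : β.HasTable tableBeta)
    (w : FreeGroup (Fin 2)) (g : V) : w.norm ≤ (V.join (g, lift ![α, β] w)).stretch := by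
  obtain ⟨y, hy, hn⟩ := exists_act_lift hα hβ w
  refine V.le_stretch (V.act_join_b hy) ?_
  rw [List.length_cons, List.length_cons (as := y)]
  omega

/-- The embedding of `F₂ × F₂` given by a pair of elements. -/
noncomputable def joinLift (α β : V) : FreeGroup (Fin 2) × FreeGroup (Fin 2) →* V :=
  V.join.comp ((lift ![α, β]).prodMap (lift ![α, β]))

theorem joinLift_inl (α β : V) (w : FreeGroup (Fin 2)) :
    joinLift α β (w, 1) = lift ![V.join (α, 1), V.join (β, 1)] w := by
  refine FreeGroup.lift_unique ((joinLift α β).comp (MonoidHom.inl _ _)) (fun i => ?_)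
  change V.join (lift ![α, β] (of i), lift ![α, β] 1) = _
  fin_cases i <;> simp

theorem joinLift_inr (α β : V) (w : FreeGroup (Fin 2)) :
    joinLift α β (1, w) = lift ![V.join (1, α), V.join (1, β)] w := by
  refine FreeGroup.lift_unique ((joinLift α β).comp (MonoidHom.inr _ _)) (fun i => ?_)
  change V.join (lift ![α, β] 1, lift ![α, β] (of i)) = _
  fin_cases i <;> simp

theorem joinLift_apply (α β : V) (w : FreeGroup (Fin 2) × FreeGroup (Fin 2)) :
    joinLift α β w = lift ![V.join (α, 1), V.join (β, 1)] w.1 *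
      lift ![V.join (1, α), V.join (1, β)] w.2 := by
  rw [← joinLift_inl, ← joinLift_inr, ← map_mul, Prod.mk_mul_mk, one_mul, mul_one]

theorem range_lift_pair {G : Type*} [Group G] (g h : G) :
    (lift ![g, h]).range = Subgroup.closure {g, h} := by
  rw [FreeGroup.range_lift_eq_closure, Matrix.range_cons, Matrix.range_cons, Matrix.range_empty,
    Set.union_empty, Set.singleton_union]

theorem range_joinLift (α β : V) : (joinLift α β).range =
    Subgroup.closure {V.join (α, 1), V.join (β, 1), V.join (1, α), V.join (1, β)} := by
  apply le_antisymm
  · rintro _ ⟨w, rfl⟩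
    rw [joinLift_apply]
    refine mul_mem ?_ ?_
    · have : lift ![V.join (α, 1), V.join (β, 1)] w.1 ∈ (lift ![V.join (α, 1), V.join (β, 1)]).range := ⟨w.1, rfl⟩
      rw [range_lift_pair] at this
      exact Subgroup.closure_mono (by grind) this
    · have : lift ![V.join (1, α), V.join (1, β)] w.2 ∈ (lift ![V.join (1, α), V.join (1, β)]).range := ⟨w.2, rfl⟩
      rw [range_lift_pair] at this
      exact Subgroup.closure_mono (by grind) this
  · rw [Subgroup.closure_le]
    rintro _ (rfl | rfl | rfl | rfl)
    · exact ⟨(of 0, 1), by simp [joinLift_apply]⟩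
    · exact ⟨(of 1, 1), by simp [joinLift_apply]⟩
    · exact ⟨(1, of 0), by simp [joinLift_apply]⟩
    · exact ⟨(1, of 1), by simp [joinLift_apply]⟩

/-- An element of the kernel has stretch zero, hence norm zero. -/
theorem injective_of_norm_le_stretch {f : FreeGroup (Fin 2) →* V}
    (h : ∀ w, w.norm ≤ (f w).stretch) : Function.Injective f := by
  refine (injective_iff_map_eq_one f).2 fun w hw => FreeGroup.norm_eq_zero.1 (Nat.le_zero.1 ?_)
  simpa [hw, V.stretch_one] using h w

theorem wordLength_lift_le {G : Type*} [Group G] (f : Fin 2 → G) (w : FreeGroup (Fin 2))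
    {S : Set G} (hS : Set.range f ⊆ S) : Distortion.wordLength S (lift f w) ≤ w.norm := by
  obtain ⟨l, hl, hprod, hlen⟩ := FreeGroup.exists_list_prod_eq_lift f w
  rw [FreeGroup.norm, ← hlen]
  exact Distortion.wordLength_le (fun x hx => (hl x hx).imp (@hS _) (@hS _)) hprod

/-- The stretch of the joined element bounds both norms, so both vanish on the kernel. -/
theorem injective_joinLift (hα : α.HasTable tableAlpha) (hβ : β.HasTable tableBeta) :
    Function.Injective (joinLift α β) := by
  refine (injective_iff_map_eq_one _).2 fun w hw => ?_
  have h₁ : w.1.norm ≤ (joinLift α β w).stretch := norm_le_stretch_join_left hα hβ w.1 _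
  have h₂ : w.2.norm ≤ (joinLift α β w).stretch := norm_le_stretch_join_right hα hβ w.2 _
  rw [hw, V.stretch_one, Nat.le_zero, FreeGroup.norm_eq_zero] at h₁ h₂
  exact Prod.ext h₁ h₂

theorem hasLinearDistortion_closure (hα : α.HasTable tableAlpha) (hβ : β.HasTable tableBeta) :
    Distortion.HasLinearDistortion (Subgroup.closure ({α, β} : Set V)) := by
  refine Distortion.hasLinearDistortion_of_subadditive (ℓ := V.stretch) (c := 1) (h₀ := α)
    (Set.toFinite _) V.stretch_one V.stretch_mul_le (fun g hg => ?_)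
    (Subgroup.subset_closure (by simp)) fun n => ?_
  · rw [← range_lift_pair] at hg
    obtain ⟨w, rfl⟩ := hg
    rw [one_mul]
    exact (wordLength_lift_le _ w (by simp [Set.pair_comm])).trans (norm_le_stretch_lift hα hβ w)
  -- The power `of 0 ^ n` is reduced of norm `n`, so the powers of `α` stretch at least linearly.
  · simpa [FreeGroup.norm_of_pow] using norm_le_stretch_lift hα hβ (of 0 ^ n)

theorem hasLinearDistortion_closure_join (hα : α.HasTable tableAlpha)
    (hβ : β.HasTable tableBeta) :
    Distortion.HasLinearDistortion (Subgroup.closure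
      ({V.join (α, 1), V.join (β, 1), V.join (1, α), V.join (1, β)} : Set V)) := by
  -- The factor 2 arises because the word length is at most the sum of two norms, each bounded by
  -- the stretch.
  refine Distortion.hasLinearDistortion_of_subadditive (ℓ := V.stretch) (c := 2)
    (h₀ := V.join (α, 1)) (Set.toFinite _) V.stretch_one V.stretch_mul_le (fun g hg => ?_)
    (Subgroup.subset_closure (by simp)) fun n => ?_
  · rw [← range_joinLift] at hg
    obtain ⟨w, rfl⟩ := hg
    have h₁ : w.1.norm ≤ (joinLift α β w).stretch := norm_le_stretch_join_left hα hβ w.1 _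
    have h₂ : w.2.norm ≤ (joinLift α β w).stretch := norm_le_stretch_join_right hα hβ w.2 _
    have h₃ : Distortion.wordLength
        ({V.join (α, 1), V.join (β, 1), V.join (1, α), V.join (1, β)} : Set V)
        (joinLift α β w) ≤ w.1.norm + w.2.norm := by
      have e₁ : joinLift α β (w.1, 1) ∈ (joinLift α β).range := ⟨_, rfl⟩
      have e₂ : joinLift α β (1, w.2) ∈ (joinLift α β).range := ⟨_, rfl⟩
      rw [range_joinLift] at e₁ e₂
      rw [joinLift_inl] at e₁
      rw [joinLift_inr] at e₂
      rw [joinLift_apply]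
      refine (Distortion.wordLength_mul_le e₁ e₂).trans (Nat.add_le_add ?_ ?_)
      · exact wordLength_lift_le _ _ (by rintro _ ⟨i, rfl⟩; fin_cases i <;> simp)
      · exact wordLength_lift_le _ _ (by rintro _ ⟨i, rfl⟩; fin_cases i <;> simp)
    omega
  · have := norm_le_stretch_join_left hα hβ (of 0 ^ n) 1
    rw [FreeGroup.norm_of_pow, map_pow, FreeGroup.lift_apply_of] at this
    rwa [← map_pow, Prod.pow_mk, one_pow]

end Thompson

/-! ### The theorem on both subgroups -/

theorem mainTheorem2 :
    ∃ α β : Thompson.V,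
      α.HasTable Thompson.tableAlpha ∧ β.HasTable Thompson.tableBeta ∧
      (∃ e : FreeGroup (Fin 2) ≃* Subgroup.closure ({α, β} : Set Thompson.V),
        (e (FreeGroup.of 0) : Thompson.V) = α ∧ (e (FreeGroup.of 1) : Thompson.V) = β) ∧
      Distortion.HasLinearDistortion (Subgroup.closure ({α, β} : Set Thompson.V)) ∧
      ∃ αa βa αb βb : Thompson.V,
        Thompson.V.IsCopyA α αa ∧ Thompson.V.IsCopyA β βa ∧
        Thompson.V.IsCopyB α αb ∧ Thompson.V.IsCopyB β βb ∧
        (∃ e : FreeGroup (Fin 2) × FreeGroup (Fin 2) ≃*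
            Subgroup.closure ({αa, βa, αb, βb} : Set Thompson.V),
          (e (FreeGroup.of 0, 1) : Thompson.V) = αa ∧
          (e (FreeGroup.of 1, 1) : Thompson.V) = βa ∧
          (e (1, FreeGroup.of 0) : Thompson.V) = αb ∧
          (e (1, FreeGroup.of 1) : Thompson.V) = βb) ∧
        Distortion.HasLinearDistortion
          (Subgroup.closure ({αa, βa, αb, βb} : Set Thompson.V)) := by
  obtain ⟨α, hα⟩ := Thompson.exists_hasTable_tableAlpha
  obtain ⟨β, hβ⟩ := Thompson.exists_hasTable_tableBeta
  refine ⟨α, β, hα, hβ, ?_, Thompson.hasLinearDistortion_closure hα hβ, Thompson.V.join (α, 1),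
    Thompson.V.join (β, 1), Thompson.V.join (1, α), Thompson.V.join (1, β),
    Thompson.V.isCopyA_join α, Thompson.V.isCopyA_join β, Thompson.V.isCopyB_join α,
    Thompson.V.isCopyB_join β, ?_, Thompson.hasLinearDistortion_closure_join hα hβ⟩
  · refine ⟨(MonoidHom.ofInjective (Thompson.injective_of_norm_le_stretch
      (Thompson.norm_le_stretch_lift hα hβ))).trans
        (MulEquiv.subgroupCongr (Thompson.range_lift_pair α β)), ?_, ?_⟩
    · exact FreeGroup.lift_apply_of
    · exact FreeGroup.lift_apply_of
  · refine ⟨(MonoidHom.ofInjective (Thompson.injective_joinLift hα hβ)).trans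
        (MulEquiv.subgroupCongr (Thompson.range_joinLift α β)), ?_, ?_, ?_, ?_⟩ <;>
      exact (Thompson.joinLift_apply α β _).trans (by simp)
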